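/- A function $h:\mathbb{R}^n\to\mathbb{R}$ is additive if $h(x)+h(y)=h(x+y)$ for all $x,y\in\mathbb{R}^n$. A probability distribution $\mathcal{D}$ on $\mathbb{R}^n$ is $(\eta,R)$-concentrated if $\Pr_{p\sim\mathcal{D}}[\|p\|_2<R]\ge 1-\eta$. A tester is a randomized algorithm with (adaptive) query access to a measurable function $f:\mathbb{R}^n\to\mathbb{R}$ and access to independent samples from a distribution $\mathcal{D}$, which at the end accepts or rejects. Theorem. There are absolute constants $C,K>0$ such that for all $n\in\mathbb{N}$ and real $\alpha,\varepsilon>0$ and $R$ with $R\,n^{1.5}\ge 1$ there is a tester, depending only on $n,\alpha,\varepsilon,R$, that makes at most $C/\varepsilon$ calls in total to its two oracles (in particular $O(1/\varepsilon)$ queries to $f$), and such that for every measurable $f:\mathbb{R}^n\to\mathbb{R}$ and every (unknown) $(\varepsilon/4,R)$-concentrated probability distribution $\mathcal{D}$ on $\mathbb{R}^n$: 1. (one-sided error) if $f$ is pointwise $\alpha$-close to some additive function, that is, if there is an additive $h$ with $|f(x)-h(x)|\le\alpha$ for all $x\in\mathbb{R}^n$, then the tester accepts $f$ with probability $1$;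 2. if for every additive function $h:\mathbb{R}^n\to\mathbb{R}$ $$\Pr_{p\sim\mathcal{D}}\bigl[\,|f(p)-h(p)|>K\,R\,n^{1.5}\,\alpha\,\bigr]>\varepsilon,$$ then the tester rejects $f$ with probability at least $2/3$. -/

import Mathlib

open MeasureTheory

/-- A randomized algorithm on functions `f : ℝⁿ → ℝ` with query access to `f` and sample access to
a probability distribution on `ℝⁿ`. It tosses its internal coins, receives `numSamples`
independent samples, and then makes `numQueries` adaptive queries to `f`: the point of query number
`k` (counted from `0`) is a measurable function of the coins, the samples and the answers to the
previous `k` queries. At the end it accepts or rejects. Neither `f` nor the distribution is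
available to it in any other way. -/
structure Tester (n : ℕ) where
  /-- the number of samples drawn from the unknown distribution -/
  numSamples : ℕ
  /-- the number of queries made to the unknown function -/
  numQueries : ℕ
  /-- the space of internal coin tosses -/
  Coins : Type
  coinsMeasurableSpace : MeasurableSpace Coins
  /-- the law of the internal coin tosses -/
  coinLaw : Measure Coins
  coinLaw_isProbabilityMeasure : IsProbabilityMeasure coinLaw
  /-- the next query point, given the coins, the samples and the first `k` answers
  (only the values for `k < numQueries` matter) -/
  query : (k : ℕ) → Coins × (Fin numSamples → EuclideanSpace ℝ (Fin n)) × (Fin k → ℝ) →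
    EuclideanSpace ℝ (Fin n)
  measurable_query : ∀ k, Measurable (query k)
  /-- the set of coins, samples and answers that make the algorithm accept -/
  acceptSet : Set (Coins × (Fin numSamples → EuclideanSpace ℝ (Fin n)) × (Fin numQueries → ℝ))
  measurableSet_acceptSet : MeasurableSet acceptSet

namespace Tester

attribute [instance] Tester.coinsMeasurableSpace Tester.coinLaw_isProbabilityMeasure

variable {n : ℕ}

/-- The answers to the first `k` queries, when the queried function is `f`, the coins are `z.1` and
the samples are `z.2`. -/
def answers (T : Tester n) (f : EuclideanSpace ℝ (Fin n) → ℝ)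
    (z : T.Coins × (Fin T.numSamples → EuclideanSpace ℝ (Fin n))) : (k : ℕ) → Fin k → ℝ
  | 0 => Fin.elim0
  | k + 1 => Fin.snoc (T.answers f z k) (f (T.query k (z.1, z.2, T.answers f z k)))

/-- The event that `T` accepts `f`. -/
def acceptEvent (T : Tester n) (f : EuclideanSpace ℝ (Fin n) → ℝ) :
    Set (T.Coins × (Fin T.numSamples → EuclideanSpace ℝ (Fin n))) :=
  {z | (z.1, z.2, T.answers f z T.numQueries) ∈ T.acceptSet}

/-- The joint law of the internal coins and of `numSamples` independent samples from `D`. -/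
noncomputable def runLaw (T : Tester n) (D : Measure (EuclideanSpace ℝ (Fin n))) :
    Measure (T.Coins × (Fin T.numSamples → EuclideanSpace ℝ (Fin n))) :=
  T.coinLaw.prod (Measure.pi fun _ => D)

/-- The probability that `T` accepts `f` when the samples come from `D`. -/
noncomputable def acceptProb (T : Tester n) (f : EuclideanSpace ℝ (Fin n) → ℝ)
    (D : Measure (EuclideanSpace ℝ (Fin n))) : ℝ :=
  (T.runLaw D).real (T.acceptEvent f)

/-- The probability that `T` rejects `f` when the samples come from `D`. -/
noncomputable def rejectProb (T : Tester n) (f : EuclideanSpace ℝ (Fin n) → ℝ)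
    (D : Measure (EuclideanSpace ℝ (Fin n))) : ℝ :=
  (T.runLaw D).real (T.acceptEvent f)ᶜ

end Tester

/-- `D` is `(ε, R)`-concentrated: the open Euclidean ball of radius `R` around the origin has
`D`-probability at least `1 - ε`. -/
def IsConcentrated {n : ℕ} (D : Measure (EuclideanSpace ℝ (Fin n))) (ε R : ℝ) : Prop :=
  1 - ε ≤ D.real (Metric.ball 0 R)

/-- `f` is pointwise `α`-close to some additive function. -/
def IsCloseToAdditive {n : ℕ} (f : EuclideanSpace ℝ (Fin n) → ℝ) (α : ℝ) : Prop :=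
  ∃ h : EuclideanSpace ℝ (Fin n) →+ ℝ, ∀ x, |f x - h x| ≤ α

/-- Every additive function differs from `f` by more than `β` with `D`-probability more
than `ε`. -/
def IsFarFromAdditive {n : ℕ} (f : EuclideanSpace ℝ (Fin n) → ℝ)
    (D : Measure (EuclideanSpace ℝ (Fin n))) (β ε : ℝ) : Prop :=
  ∀ h : EuclideanSpace ℝ (Fin n) →+ ℝ, ε < D.real {p | β < |f p - h p|}

/-!
If `f (x + y)` is usually close to `f x + f y` for independent `x, y` drawn from an almost
translation-invariant law, such as the uniform law on a huge ball, then for every `p` in a smaller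
ball the differences `f (p + x) - f x` concentrate around a value `g p`. This self-correction `g` of
`f` is approximately additive at all points of the ball, not only at typical ones, and is therefore
close to a truly additive function: extend it by periodicity along a lattice, and apply Hyers'
theorem to the extension. Hence either the condition at random `(x, y)` fails often, or, when `f` is
far from additive, a sample `p` often has `f p` far from `g p`, and then `f (p + x) - f x - f p` is
large for most `x`. Both violations are visible from a constant number of queries, and `O(1 / ε)`
independent repetitions find one of them.
-/

section ApproxAdditive

variable {V W : Type*}

/-- The defect `f (x + y) - f x - f y` from additivity of `f` at the pair `(x, y)`. -/
def addDefect [Add V] [Sub W] (f : V → W) (x y : V) : W := f (x + y) - f x - f y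

/-- `f` is additive on `s` up to an error `δ`: its defect from additivity has norm at most `δ` at
all pairs of points of `s` whose sum lies in `s` as well. -/
def IsApproxAdditiveOn [Add V] [NormedAddCommGroup W] (f : V → W) (s : Set V) (δ : ℝ) : Prop :=
  ∀ ⦃x⦄, x ∈ s → ∀ ⦃y⦄, y ∈ s → x + y ∈ s → ‖addDefect f x y‖ ≤ δ

theorem IsApproxAdditiveOn.exists_addMonoidHom_norm_sub_le [AddCommMonoid V]
    [NormedAddCommGroup W] [NormedSpace ℝ W] [CompleteSpace W] {f : V → W} {δ : ℝ}
    (hf : IsApproxAdditiveOn f Set.univ δ) : ∃ h : V →+ W, ∀ x, ‖f x - h x‖ ≤ δ := by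
  let u (x : V) (k : ℕ) : W := ((2 : ℝ) ^ k)⁻¹ • f (2 ^ k • x)
  have norm_scaled_defect_le (x y : V) (k : ℕ) :
      ‖((2 : ℝ) ^ k)⁻¹ • addDefect f (2 ^ k • x) (2 ^ k • y)‖ ≤ δ / 2 ^ k := by
    rw [norm_smul, norm_inv, norm_pow, Real.norm_two, inv_mul_eq_div]
    gcongr
    exact hf trivial trivial trivial
  have dist_succ_le (x : V) (k : ℕ) : dist (u x k) (u x (k + 1)) ≤ δ / 2 / 2 ^ k := by
    have hdouble : u x (k + 1) - u x k =
        (2⁻¹ : ℝ) • ((2 : ℝ) ^ k)⁻¹ • addDefect f (2 ^ k • x) (2 ^ k • x) := by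
      have hpow : 2 ^ k • x + 2 ^ k • x = 2 ^ (k + 1) • x := by
        rw [← two_nsmul, smul_smul, pow_succ']
      simp only [u, addDefect, hpow]
      rw [pow_succ' (2 : ℝ), mul_inv]
      module
    rw [dist_comm, dist_eq_norm, hdouble, norm_smul, norm_inv, Real.norm_two, div_right_comm,
      inv_mul_eq_div]
    gcongr
    exact norm_scaled_defect_le x x k
  choose h hlim using fun x => cauchySeq_tendsto_of_complete
    (cauchySeq_of_le_geometric_two (dist_succ_le x))
  have hadd (x y : V) : h (x + y) = h x + h y := by
    have hdefect : Filter.Tendsto (fun k => u (x + y) k - u x k - u y k) Filter.atTop (nhds 0) := by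
      refine squeeze_zero_norm (a := fun k => δ / 2 ^ k) (fun k => ?_)
        (tendsto_const_nhds.div_atTop (tendsto_pow_atTop_atTop_of_one_lt one_lt_two))
      simpa only [u, addDefect, smul_sub, ← nsmul_add] using norm_scaled_defect_le x y k
    have := tendsto_nhds_unique (((hlim (x + y)).sub (hlim x)).sub (hlim y)) hdefect
    rwa [sub_sub, sub_eq_zero] at this
  refine ⟨AddMonoidHom.mk' h hadd, fun x => ?_⟩
  simpa [u, dist_eq_norm] using dist_le_of_le_geometric_two_of_tendsto₀ (dist_succ_le x) (hlim x)

variable [NormedAddCommGroup V] [NormedAddCommGroup W] {f : V → W} {ρ δ : ℝ}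

open Metric

theorem IsApproxAdditiveOn.norm_add_zsmul_sub_le (hf : IsApproxAdditiveOn f (closedBall 0 ρ) δ)
    {v w : V} (hρ : ‖v‖ + ‖w‖ ≤ ρ) {c : ℤ} (hc : |c| ≤ 1) :
    ‖f (v + c • w) - f v - c • f w‖ ≤ δ := by
  have hv : v ∈ closedBall 0 ρ := mem_closedBall_zero_iff.2 (by linarith [norm_nonneg w])
  have hw : w ∈ closedBall 0 ρ := mem_closedBall_zero_iff.2 (by linarith [norm_nonneg v])
  have hadd : v + w ∈ closedBall 0 ρ := mem_closedBall_zero_iff.2 ((norm_add_le _ _).trans hρ)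
  have hsub : v - w ∈ closedBall 0 ρ := mem_closedBall_zero_iff.2 ((norm_sub_le _ _).trans hρ)
  obtain rfl | rfl | rfl : c = -1 ∨ c = 0 ∨ c = 1 := by rw [abs_le] at hc; omega
  · have hneg : f (v + (-1 : ℤ) • w) - f v - (-1 : ℤ) • f w = -addDefect f (v - w) w := by
      rw [addDefect, sub_add_cancel, neg_one_zsmul, ← sub_eq_add_neg]
      abel
    rw [hneg, norm_neg]
    exact hf hsub hw (by rwa [sub_add_cancel])
  · simpa using (norm_nonneg _).trans (hf hv hw hadd)
  · simpa only [one_smul, addDefect] using hf hv hw hadd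

theorem IsApproxAdditiveOn.norm_add_sum_zsmul_sub_le {ι : Type*} (s : Finset ι)
    (hf : IsApproxAdditiveOn f (closedBall 0 ρ) δ) {v : V} {b : ι → V}
    (hρ : ‖v‖ + ∑ i ∈ s, ‖b i‖ ≤ ρ) {c : ι → ℤ} (hc : ∀ i ∈ s, |c i| ≤ 1) :
    ‖f (v + ∑ i ∈ s, c i • b i) - f v - ∑ i ∈ s, c i • f (b i)‖ ≤ s.card * δ := by
  classical
  induction s using Finset.induction_on with
  | empty => simp
  | insert i s hi ih =>
    simp only [Finset.sum_insert hi] at hρ ⊢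
    set v' := v + ∑ j ∈ s, c j • b j
    have hv' : ‖v'‖ ≤ ‖v‖ + ∑ j ∈ s, ‖b j‖ := by
      refine norm_add_le_of_le le_rfl (norm_sum_le_of_le s fun j hj => ?_)
      have : (|c j| : ℝ) ≤ 1 := by exact_mod_cast hc j (Finset.mem_insert_of_mem hj)
      exact (norm_zsmul_le _ _).trans (mul_le_of_le_one_left (norm_nonneg _) this)
    have hlast := hf.norm_add_zsmul_sub_le (v := v') (w := b i) (by linarith)
      (hc i (Finset.mem_insert_self i s))
    have hinit := ih (by linarith [norm_nonneg (b i)])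
      fun j hj => hc j (Finset.mem_insert_of_mem hj)
    calc ‖f (v + (c i • b i + ∑ j ∈ s, c j • b j)) - f v
          - (c i • f (b i) + ∑ j ∈ s, c j • f (b j))‖
        = ‖(f (v' + c i • b i) - f v' - c i • f (b i))
          + (f v' - f v - ∑ j ∈ s, c j • f (b j))‖ := by
          rw [add_left_comm, add_comm (c i • b i)]
          congr 1
          abel
      _ ≤ δ + s.card * δ := norm_add_le_of_le hlast hinit
      _ = (insert i s).card * δ := by
          rw [Finset.card_insert_of_notMem hi]
          push_cast
          ring

variable [NormedSpace ℝ W]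

theorem IsApproxAdditiveOn.norm_nsmul_sub_le (hf : IsApproxAdditiveOn f (closedBall 0 ρ) δ) (x : V)
    (k : ℕ) (hx : (k + 1) * ‖x‖ ≤ ρ) : ‖f ((k + 1) • x) - (k + 1 : ℝ) • f x‖ ≤ k * δ := by
  induction k with
  | zero => simp
  | succ k ih =>
    have norm_nsmul_le_radius (j : ℕ) (hj : j ≤ k + 2) : j • x ∈ closedBall 0 ρ := by
      have : (j : ℝ) ≤ (k + 1 : ℕ) + 1 := by exact_mod_cast hj
      refine mem_closedBall_zero_iff.2 (norm_nsmul_le.trans (le_trans ?_ hx))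
      gcongr
    have hdefect : ‖addDefect f ((k + 1) • x) x‖ ≤ δ := by
      refine hf (norm_nsmul_le_radius _ (by omega)) ?_ ?_
      · simpa using norm_nsmul_le_radius 1 (by omega)
      · simpa only [succ_nsmul] using norm_nsmul_le_radius (k + 2) le_rfl
    have ih := ih (by push_cast at hx; nlinarith [norm_nonneg x])
    calc ‖f ((k + 1 + 1) • x) - ((k + 1 : ℕ) + 1 : ℝ) • f x‖
        = ‖addDefect f ((k + 1) • x) x + (f ((k + 1) • x) - (k + 1 : ℝ) • f x)‖ := by
          rw [addDefect, ← succ_nsmul]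
          push_cast
          congr 1
          module
      _ ≤ δ + k * δ := norm_add_le_of_le hdefect ih
      _ = (k + 1 : ℕ) * δ := by push_cast; ring

theorem IsApproxAdditiveOn.norm_sub_le_two_mul (hf : IsApproxAdditiveOn f (closedBall 0 ρ) δ)
    (h : V →+ W) (k : ℕ) {r : ℝ} (hρ : (k + 1) * r ≤ ρ)
    (hfh : ∀ x, ‖x‖ ≤ (k + 1) * r → ‖f x - h x‖ ≤ (k + 1) * δ) {x : V} (hx : ‖x‖ ≤ r) :
    ‖f x - h x‖ ≤ 2 * δ := by
  have hx' : (k + 1) * ‖x‖ ≤ (k + 1) * r := by gcongr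
  have hmul := hf.norm_nsmul_sub_le x k (hx'.trans hρ)
  have hclose : ‖f ((k + 1) • x) - h ((k + 1) • x)‖ ≤ (k + 1) * δ :=
    hfh _ (norm_nsmul_le.trans (by exact_mod_cast hx'))
  have hδ : 0 ≤ δ := by nlinarith [norm_nonneg (f ((k + 1) • x) - h ((k + 1) • x))]
  have hsplit : (k + 1 : ℝ) • (f x - h x) =
      (f ((k + 1) • x) - h ((k + 1) • x)) - (f ((k + 1) • x) - (k + 1 : ℝ) • f x) := by
    rw [map_nsmul, ← Nat.cast_smul_eq_nsmul ℝ (k + 1) (h x)]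
    push_cast
    module
  refine le_of_mul_le_mul_left (a := (k + 1 : ℝ)) ?_ (by positivity)
  calc (k + 1) * ‖f x - h x‖ = ‖(k + 1 : ℝ) • (f x - h x)‖ := by
        rw [norm_smul, Real.norm_of_nonneg (by positivity)]
    _ ≤ (k + 1) * δ + k * δ := hsplit ▸ norm_sub_le_of_le hclose hmul
    _ ≤ (k + 1) * (2 * δ) := by linarith

end ApproxAdditive

section LocalStability

open Metric Module

theorem abs_floor_add_floor_sub_floor_add_le_one {K : Type*} [Field K] [LinearOrder K]
    [IsStrictOrderedRing K] [FloorRing K] (a b : K) : |⌊a⌋ + ⌊b⌋ - ⌊a + b⌋| ≤ 1 := by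
  have := Int.le_floor_add a b
  have := Int.le_floor_add_floor a b
  rw [abs_le]
  omega

variable {V W : Type*} [NormedAddCommGroup V] [NormedSpace ℝ V]

theorem exists_basis_abs_repr_le_one [FiniteDimensional ℝ V] (r : ℝ) :
    ∃ b : Basis (Fin (finrank ℝ V)) ℝ V, ∀ x, ‖x‖ ≤ r → ∀ i, |b.repr x i| ≤ 1 := by
  let b := finBasis ℝ V
  let L : V →L[ℝ] Fin (finrank ℝ V) → ℝ := b.equivFunL
  have hs : 0 < ‖L‖ * |r| + 1 := by positivity
  refine ⟨b.isUnitSMul fun _ => hs.ne'.isUnit, fun x hx i => ?_⟩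
  have hLx : |b.repr x i| ≤ ‖L‖ * |r| + 1 :=
    calc |b.repr x i| ≤ ‖L x‖ := norm_le_pi_norm (L x) i
      _ ≤ ‖L‖ * |r| := L.le_opNorm_of_le (hx.trans (le_abs_self r))
      _ ≤ ‖L‖ * |r| + 1 := by linarith
  rw [Basis.repr_isUnitSMul, Units.smul_def, Units.val_inv_eq_inv_val, IsUnit.unit_spec,
    smul_eq_mul, abs_mul, abs_inv, abs_of_pos hs, inv_mul_eq_div]
  exact (div_le_one hs).2 hLx

variable {ι : Type*} [Fintype ι] (b : Basis ι ℝ V)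

theorem zspan_fract_add_sum_floor (x : V) :
    ZSpan.fract b x + ∑ i, ⌊b.repr x i⌋ • b i = x := by
  simp [ZSpan.fract_apply, ZSpan.floor]

theorem zspan_fract_add (x y : V) :
    ZSpan.fract b (x + y) = ZSpan.fract b x + ZSpan.fract b y +
      ∑ i, (⌊b.repr x i⌋ + ⌊b.repr y i⌋ - ⌊b.repr (x + y) i⌋) • b i := by
  simp only [sub_smul, add_smul, Finset.sum_sub_distrib, Finset.sum_add_distrib,
    eq_sub_of_add_eq (zspan_fract_add_sum_floor b _)]
  abel

variable [NormedAddCommGroup W] {f : V → W} {ρ δ : ℝ}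

/-- The extension of `f` from the fundamental parallelepiped of the lattice spanned by the basis
`b` to the whole space by the additive function on that lattice which agrees with `f` on `b`. It
turns a function approximately additive on a ball into one approximately additive everywhere. -/
noncomputable def latticeExtension (f : V → W) (x : V) : W :=
  f (ZSpan.fract b x) + ∑ i, ⌊b.repr x i⌋ • f (b i)

theorem isApproxAdditiveOn_latticeExtension (hf : IsApproxAdditiveOn f (closedBall 0 ρ) δ)
    (hρ : 3 * ∑ i, ‖b i‖ ≤ ρ) :
    IsApproxAdditiveOn (latticeExtension b f) Set.univ ((Fintype.card ι + 1) * δ) := by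
  intro x _ y _ _
  let c (i : ι) : ℤ := ⌊b.repr x i⌋ + ⌊b.repr y i⌋ - ⌊b.repr (x + y) i⌋
  let v := ZSpan.fract b x
  let w := ZSpan.fract b y
  have hc (i : ι) : |c i| ≤ 1 := by
    simpa only [c, map_add, Finsupp.add_apply] using abs_floor_add_floor_sub_floor_add_le_one _ _
  have hv : ‖v‖ ≤ ∑ i, ‖b i‖ := ZSpan.norm_fract_le b x
  have hw : ‖w‖ ≤ ∑ i, ‖b i‖ := ZSpan.norm_fract_le b y
  have hvw : ‖v + w‖ ≤ ‖v‖ + ‖w‖ := norm_add_le v w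
  have hcarry : ‖f (v + w + ∑ i, c i • b i) - f (v + w) - ∑ i, c i • f (b i)‖ ≤
      Fintype.card ι * δ :=
    hf.norm_add_sum_zsmul_sub_le Finset.univ (by linarith) fun i _ => hc i
  have hdefect : ‖addDefect f v w‖ ≤ δ := by
    refine hf ?_ ?_ ?_ <;> rw [mem_closedBall_zero_iff] <;> linarith [norm_nonneg v, norm_nonneg w]
  calc ‖addDefect (latticeExtension b f) x y‖
      = ‖(f (v + w + ∑ i, c i • b i) - f (v + w) - ∑ i, c i • f (b i)) + addDefect f v w‖ := by
        simp only [addDefect, latticeExtension, zspan_fract_add, c, sub_smul, add_smul,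
          Finset.sum_sub_distrib, Finset.sum_add_distrib, v, w]
        congr 1
        abel
    _ ≤ Fintype.card ι * δ + δ := norm_add_le_of_le hcarry hdefect
    _ = (Fintype.card ι + 1) * δ := by ring

theorem norm_sub_latticeExtension_le (hf : IsApproxAdditiveOn f (closedBall 0 ρ) δ)
    (hρ : 2 * ∑ i, ‖b i‖ ≤ ρ) {x : V} (hx : ∀ i, |b.repr x i| ≤ 1) :
    ‖f x - latticeExtension b f x‖ ≤ Fintype.card ι * δ := by
  have hfloor (i : ι) : |⌊b.repr x i⌋| ≤ 1 := by
    obtain ⟨hlower, hupper⟩ := abs_le.1 (hx i)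
    refine abs_le.2 ⟨Int.le_floor.2 (by exact_mod_cast hlower), ?_⟩
    exact_mod_cast (Int.floor_le _).trans hupper
  have hfract : ‖ZSpan.fract b x‖ ≤ ∑ i, ‖b i‖ := ZSpan.norm_fract_le b x
  have := hf.norm_add_sum_zsmul_sub_le Finset.univ (v := ZSpan.fract b x) (b := b) (by linarith)
    fun i _ => hfloor i
  rwa [zspan_fract_add_sum_floor, sub_sub, Finset.card_univ] at this

-- The dimension enters `latticeExtension` as an error factor of order `2 d + 1`; comparing `f x`
-- with `f ((2 d + 1) • x)` divides it out again, which is why `ρ` has to exceed `r`.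
theorem exists_radius_forall_isApproxAdditiveOn_exists_addMonoidHom (V W : Type*)
    [NormedAddCommGroup V] [NormedSpace ℝ V] [FiniteDimensional ℝ V] [NormedAddCommGroup W]
    [NormedSpace ℝ W] [CompleteSpace W] (r : ℝ) :
    ∃ ρ, r ≤ ρ ∧ ∀ (f : V → W) (δ : ℝ), IsApproxAdditiveOn f (closedBall 0 ρ) δ →
      ∃ h : V →+ W, ∀ x, ‖x‖ ≤ r → ‖f x - h x‖ ≤ 2 * δ := by
  let d := finrank ℝ V
  let r' := (2 * d + 1) * |r|
  obtain ⟨b, hb⟩ := exists_basis_abs_repr_le_one (V := V) r'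
  have hb₀ : 0 ≤ ∑ i, ‖b i‖ := by positivity
  have hr : |r| ≤ r' := le_mul_of_one_le_left (abs_nonneg r) (by simp)
  refine ⟨r' + 3 * ∑ i, ‖b i‖, by linarith [le_abs_self r], fun f δ hf => ?_⟩
  obtain ⟨h, hh⟩ := (isApproxAdditiveOn_latticeExtension b hf
    (by linarith [abs_nonneg r])).exists_addMonoidHom_norm_sub_le
  have hfh (y : V) (hy : ‖y‖ ≤ r') : ‖f y - h y‖ ≤ (2 * d + 1) * δ :=
    calc ‖f y - h y‖ ≤ ‖f y - latticeExtension b f y‖ + ‖latticeExtension b f y - h y‖ :=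
          norm_sub_le_norm_sub_add_norm_sub _ _ _
      _ ≤ d * δ + (d + 1) * δ := by
          refine add_le_add ?_ (by simpa only [Fintype.card_fin] using hh y)
          simpa only [Fintype.card_fin] using
            norm_sub_latticeExtension_le b hf (by linarith [abs_nonneg r]) (hb y hy)
      _ = (2 * d + 1) * δ := by ring
  refine ⟨h, fun x hx => hf.norm_sub_le_two_mul h (2 * d) (r := |r|) ?_ (fun y hy => ?_)
    (hx.trans (le_abs_self r))⟩
  · push_cast
    linarith
  · push_cast at hy ⊢
    exact hfh y hy

end LocalStability

section AlmostInvariant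

variable {V : Type*} [MeasurableSpace V]

/-- `μ` is invariant under the translation by `p` up to an error `η` in total variation: no
event gains more than `η` in measure when `μ` is translated by `p`. -/
def IsAlmostInvariantUnder [Add V] (μ : Measure V) (η : ℝ) (p : V) : Prop :=
  ∀ A, μ.real ((p + ·) ⁻¹' A) ≤ μ.real A + η

open Metric Module ProbabilityTheory

variable [NormedAddCommGroup V] [NormedSpace ℝ V] [FiniteDimensional ℝ V] [BorelSpace V]

theorem measureReal_ball_add_sdiff_ball (ν : Measure V) [ν.IsAddHaarMeasure] {r s : ℝ} (hr : 0 < r)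
    (hs : 0 ≤ s) : ν.real (ball 0 (r + s) \ ball 0 r) =
      (((r + s) / r) ^ finrank ℝ V - 1) * ν.real (ball 0 r) := by
  rw [measureReal_sdiff (ball_subset_ball (by linarith)) measurableSet_ball
    measure_ball_lt_top.ne]
  nth_rw 1 [← div_mul_cancel₀ (r + s) hr.ne']
  rw [measureReal_def, Measure.addHaar_ball_mul_of_pos ν 0 (by positivity), ENNReal.toReal_mul,
    ENNReal.toReal_ofReal (by positivity), ← measureReal_def]
  ring

theorem isAlmostInvariantUnder_cond_ball (ν : Measure V) [ν.IsAddHaarMeasure] {r s : ℝ}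
    (hr : 0 < r) {p : V} (hp : ‖p‖ ≤ s) :
    IsAlmostInvariantUnder (cond ν (ball 0 r)) (((r + s) / r) ^ finrank ℝ V - 1) p := by
  intro A
  have hs : 0 ≤ s := (norm_nonneg p).trans hp
  have hv : 0 < ν.real (ball 0 r) :=
    ENNReal.toReal_pos (measure_ball_pos _ _ hr).ne' measure_ball_lt_top.ne
  have hshift : ν.real (ball 0 r ∩ (p + ·) ⁻¹' A) = ν.real (ball p r ∩ A) := by
    have : ball 0 r ∩ (p + ·) ⁻¹' A = (p + ·) ⁻¹' (ball p r ∩ A) := by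
      rw [Set.preimage_inter, preimage_add_ball, sub_self]
    rw [this, measureReal_def, measure_preimage_add, measureReal_def]
  have hsub : ball p r ∩ A ⊆ ball 0 r ∩ A ∪ ball 0 (r + s) \ ball 0 r := by
    rintro x ⟨hx, hxA⟩
    have hx' : x ∈ ball 0 (r + s) := ball_subset_ball' (by simpa using hp) hx
    by_cases hxr : x ∈ ball 0 r
    · exact Or.inl ⟨hxr, hxA⟩
    · exact Or.inr ⟨hx', hxr⟩
  have hannulus := measureReal_ball_add_sdiff_ball ν hr hs
  have hcond (B : Set V) : (cond ν (ball 0 r)).real B =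
      ν.real (ball 0 r ∩ B) / ν.real (ball 0 r) := by
    rw [measureReal_def, cond_apply measurableSet_ball, ENNReal.toReal_mul, ENNReal.toReal_inv,
      inv_mul_eq_div, ← measureReal_def, ← measureReal_def]
  rw [hcond, hcond, hshift, div_add' _ _ _ hv.ne', ← hannulus]
  gcongr
  have (t : ℝ) (q : V) (B : Set V) : ν (ball q t ∩ B) ≠ ⊤ :=
    measure_ne_top_of_subset Set.inter_subset_left measure_ball_lt_top.ne
  exact (measureReal_mono hsub (measure_union_ne_top (this _ _ _) (this _ _ _))).trans
    (measureReal_union_le _ _)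

variable (V) in
theorem exists_forall_isAlmostInvariantUnder (ρ : ℝ) {η : ℝ} (hη : 0 < η) :
    ∃ μ : Measure V, IsProbabilityMeasure μ ∧ ∀ p, ‖p‖ ≤ ρ → IsAlmostInvariantUnder μ η p := by
  have hlim : Filter.Tendsto (fun r : ℝ => ((r + ρ) / r) ^ finrank ℝ V - 1) Filter.atTop
      (nhds 0) := by
    have : Filter.Tendsto (fun r : ℝ => (1 + ρ / r) ^ finrank ℝ V - 1) Filter.atTop
        (nhds ((1 + 0) ^ finrank ℝ V - 1)) :=
      (((tendsto_const_nhds.div_atTop Filter.tendsto_id).const_add 1).pow _).sub_const 1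
    rw [add_zero, one_pow, sub_self] at this
    refine this.congr' ?_
    filter_upwards [Filter.eventually_ne_atTop 0] with r hr
    rw [add_div, div_self hr]
  obtain ⟨r, hrη, hr⟩ := ((hlim.eventually_lt_const hη).and (Filter.eventually_gt_atTop 0)).exists
  refine ⟨cond Measure.addHaar (ball 0 r), cond_isProbabilityMeasure_of_finite
    (measure_ball_pos _ _ hr).ne' measure_ball_lt_top.ne, fun p hp A => ?_⟩
  exact (isAlmostInvariantUnder_cond_ball Measure.addHaar hr hp A).trans (by gcongr)

end AlmostInvariant

section ProductMeasure

variable {X Y : Type*} [MeasurableSpace X] [MeasurableSpace Y] (μ : Measure X) (ν : Measure Y)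
  [IsFiniteMeasure ν] {S : Set (X × Y)}

theorem measureReal_prod_eq_integral (hS : MeasurableSet S) :
    (μ.prod ν).real S = ∫ x, ν.real (Prod.mk x ⁻¹' S) ∂μ := by
  rw [measureReal_def, Measure.prod_apply hS]
  exact (integral_toReal (measurable_measure_prodMk_left hS).aemeasurable
    (.of_forall fun x => measure_lt_top _ _)).symm

theorem exists_measureReal_preimage_prodMk_le [IsProbabilityMeasure μ] (hS : MeasurableSet S) :
    ∃ x, ν.real (Prod.mk x ⁻¹' S) ≤ (μ.prod ν).real S := by
  rw [measureReal_prod_eq_integral μ ν hS]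
  exact exists_le_integral (Measure.integrable_measure_prodMk_left hS (measure_ne_top _ _))

theorem mul_measureReal_le_measureReal_prod [IsFiniteMeasure μ] (hS : MeasurableSet S) {Q : Set X}
    {θ : ℝ} (hθ : 0 ≤ θ) (hQ : ∀ x ∈ Q, θ ≤ ν.real (Prod.mk x ⁻¹' S)) :
    θ * μ.real Q ≤ (μ.prod ν).real S := by
  rw [measureReal_prod_eq_integral μ ν hS]
  exact (mul_le_mul_of_nonneg_left (measureReal_mono hQ) hθ).trans
    (mul_meas_ge_le_integral_of_nonneg (.of_forall fun _ => measureReal_nonneg)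
      (Measure.integrable_measure_prodMk_left hS (measure_ne_top _ _)) θ)

variable {ν} in
theorem IsAlmostInvariantUnder.measureReal_prod_le [IsProbabilityMeasure μ] [Add Y]
    [MeasurableAdd Y] {η : ℝ} {p : Y} (hν : IsAlmostInvariantUnder ν η p) (hS : MeasurableSet S) :
    (μ.prod ν).real (Prod.map id (p + ·) ⁻¹' S) ≤ (μ.prod ν).real S + η := by
  have hpS : MeasurableSet (Prod.map id (p + ·) ⁻¹' S) :=
    measurable_id.prodMap (measurable_const_add p) hS
  have hint {T : Set (X × Y)} (hT : MeasurableSet T) :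
      Integrable (fun x => ν.real (Prod.mk x ⁻¹' T)) μ :=
    Measure.integrable_measure_prodMk_left hT (measure_ne_top _ _)
  calc (μ.prod ν).real (Prod.map id (p + ·) ⁻¹' S)
      = ∫ x, ν.real ((p + ·) ⁻¹' (Prod.mk x ⁻¹' S)) ∂μ := measureReal_prod_eq_integral μ ν hpS
    _ ≤ ∫ x, (ν.real (Prod.mk x ⁻¹' S) + η) ∂μ :=
        integral_mono (hint hpS) ((hint hS).add (integrable_const _)) fun x => hν _
    _ = (μ.prod ν).real S + η := by
        rw [integral_add (hint hS) (integrable_const _), measureReal_prod_eq_integral μ ν hS,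
          integral_const, probReal_univ, one_smul]

end ProductMeasure

section SelfCorrection

variable {V : Type*} [AddCommSemigroup V] [MeasurableSpace V] {μ : Measure V} {f : V → ℝ}

/-- The majority vote for the value of an additive function near `f` at `p`: for all but a quarter
of the random base points `x`, the difference `f (p + x) - f x` is within `τ` of `c`. -/
def IsSelfCorrection (μ : Measure V) (f : V → ℝ) (τ : ℝ) (p : V) (c : ℝ) : Prop :=
  μ.real {x | τ < |f (p + x) - f x - c|} ≤ 1 / 4

variable [IsProbabilityMeasure μ] {τ : ℝ} {p q : V}

theorem IsSelfCorrection.abs_sub_sub_le (hμ : IsAlmostInvariantUnder μ (1 / 16) q)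
    {a b c : ℝ} (ha : IsSelfCorrection μ f τ p a) (hb : IsSelfCorrection μ f τ q b)
    (hc : IsSelfCorrection μ f τ (p + q) c) :
    |c - a - b| ≤ 3 * τ := by
  let bad (v : V) (t : ℝ) : Set V := {x | τ < |f (v + x) - f x - t|}
  obtain ⟨x, hx⟩ : ∃ x, x ∉ (q + ·) ⁻¹' bad p a ∪ bad q b ∪ bad (p + q) c := by
    by_contra! hall
    have hunion := measureReal_union_le (μ := μ) ((q + ·) ⁻¹' bad p a ∪ bad q b) (bad (p + q) c)
    rw [Set.eq_univ_of_forall hall, probReal_univ] at hunion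
    have := measureReal_union_le (μ := μ) ((q + ·) ⁻¹' bad p a) (bad q b)
    have hbad_p := hμ (bad p a)
    unfold IsSelfCorrection at ha hb hc
    linarith
  simp only [bad, Set.mem_union, not_or, Set.mem_preimage, Set.mem_ofPred_eq, not_lt] at hx
  obtain ⟨⟨hp, hq⟩, hpq⟩ := hx
  rw [← add_assoc] at hp
  rw [abs_le] at hp hq hpq ⊢
  constructor <;> linarith

variable [MeasurableAdd₂ V]

theorem measurableSet_setOf_lt_abs_addDefect (hf : Measurable f) (τ : ℝ) :
    MeasurableSet {z : V × V | τ < |addDefect f z.1 z.2|} := by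
  unfold addDefect
  exact measurableSet_lt measurable_const (by fun_prop)

theorem IsSelfCorrection.three_div_four_le_measureReal (hf : Measurable f) {c σ : ℝ}
    (hc : IsSelfCorrection μ f τ p c) (hfar : σ + τ < |f p - c|) :
    3 / 4 ≤ μ.real {x | σ < |addDefect f p x|} := by
  have hmeas : MeasurableSet {x | τ < |f (p + x) - f x - c|} :=
    measurableSet_lt measurable_const (by fun_prop)
  have hgood : 3 / 4 ≤ μ.real {x | τ < |f (p + x) - f x - c|}ᶜ := by
    rw [probReal_compl_eq_one_sub hmeas]
    unfold IsSelfCorrection at hc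
    linarith
  refine hgood.trans (measureReal_mono fun x hx => ?_)
  have hx : |f (p + x) - f x - c| ≤ τ := not_lt.1 hx
  have hsplit : f p - c = (f (p + x) - f x - c) - addDefect f p x := by
    rw [addDefect]
    ring
  have := hsplit ▸ abs_sub (f (p + x) - f x - c) (addDefect f p x)
  exact Set.mem_ofPred.2 (by linarith)

theorem exists_isSelfCorrection (hf : Measurable f) (hμ : IsAlmostInvariantUnder μ (1 / 16) p)
    (hdefect : (μ.prod μ).real {z | τ < |addDefect f z.1 z.2|} ≤ 1 / 16) :
    ∃ c, IsSelfCorrection μ f (2 * τ) p c := by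
  set S : Set (V × V) := {z | τ < |addDefect f z.1 z.2|}
  let S' := Prod.map id (p + ·) ⁻¹' S
  have hS : MeasurableSet S := measurableSet_setOf_lt_abs_addDefect hf _
  have hS' : MeasurableSet S' := measurable_id.prodMap (measurable_const_add p) hS
  have hle : (μ.prod μ).real S' ≤ 1 / 8 := by linarith [hμ.measureReal_prod_le μ hS]
  have hswap : (μ.prod μ).real (Prod.swap ⁻¹' S') = (μ.prod μ).real S' :=
    Measure.measurePreserving_swap.measureReal_preimage hS'.nullMeasurableSet
  obtain ⟨y, hy⟩ := exists_measureReal_preimage_prodMk_le μ μ (hS'.union (measurable_swap hS'))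
  refine ⟨f (p + y) - f y, le_trans (measureReal_mono fun x hx => ?_)
    (hy.trans ((measureReal_union_le _ _).trans (by linarith)))⟩
  -- `f (y + (p + x))` is close to `f y + f (p + x)` and, regrouped, to `f x + f (p + y)`.
  by_contra hgood
  have hyx : |addDefect f y (p + x)| ≤ τ := not_lt.1 fun h => hgood (Or.inl h)
  have hxy : |addDefect f x (p + y)| ≤ τ := not_lt.1 fun h => hgood (Or.inr h)
  refine (not_lt.2 ?_ : ¬ 2 * τ < |f (p + x) - f x - (f (p + y) - f y)|) hx
  calc |f (p + x) - f x - (f (p + y) - f y)|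
      = |addDefect f x (p + y) - addDefect f y (p + x)| := by
        rw [addDefect, addDefect, add_left_comm x p y, add_left_comm y p x, add_comm y x]
        congr 1
        ring
    _ ≤ |addDefect f x (p + y)| + |addDefect f y (p + x)| := abs_sub _ _
    _ ≤ 2 * τ := by linarith

/-- The runs `((x, y), p)` on which `f` is seen to violate additivity by more than `τ`, either at
`(x, y)` or at `(p, x)`. The first kind is frequent when `f` has no self-correction, the second when
`f` is far from its self-correction. -/
def violationSet (f : V → ℝ) (τ : ℝ) : Set ((V × V) × V) :=
  {w | τ < |addDefect f w.1.1 w.1.2| ∨ τ < |addDefect f w.2 w.1.1|}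

variable {D : Measure V} [IsProbabilityMeasure D]

theorem measureReal_lt_abs_addDefect_le_violationSet_coins (hf : Measurable f) (τ : ℝ) :
    (μ.prod μ).real {z | τ < |addDefect f z.1 z.2|} ≤
      ((μ.prod μ).prod D).real (violationSet f τ) := by
  have hfst : MeasurePreserving Prod.fst ((μ.prod μ).prod D) (μ.prod μ) := measurePreserving_fst
  rw [← hfst.measureReal_preimage (measurableSet_setOf_lt_abs_addDefect hf τ).nullMeasurableSet]
  exact measureReal_mono fun w hw => Or.inl hw

theorem measureReal_lt_abs_addDefect_le_violationSet_sample (hf : Measurable f) (τ : ℝ) :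
    (D.prod μ).real {z | τ < |addDefect f z.1 z.2|} ≤
      ((μ.prod μ).prod D).real (violationSet f τ) := by
  have hpair : MeasurePreserving (fun w : (V × V) × V => (w.2, w.1.1)) ((μ.prod μ).prod D)
      (D.prod μ) :=
    Measure.measurePreserving_swap.comp
      ((measurePreserving_fst (μ := μ) (ν := μ)).prod (MeasurePreserving.id D))
  rw [← hpair.measureReal_preimage (measurableSet_setOf_lt_abs_addDefect hf τ).nullMeasurableSet]
  exact measureReal_mono fun w hw => Or.inr hw

end SelfCorrection

section Detection

open Metric

-- The constant is `15 = (1 + 2) + 2 * 6`: a self-correction at `p` more than `τ + 2 * τ` away from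
-- `f p` is noticed, and self-corrections have defect `6 * τ`, hence lie within `12 * τ` of `h`.
theorem exists_measure_forall_exists_addMonoidHom (V : Type*) [NormedAddCommGroup V]
    [NormedSpace ℝ V] [FiniteDimensional ℝ V] [MeasurableSpace V] [BorelSpace V] (R : ℝ) :
    ∃ μ : Measure V, IsProbabilityMeasure μ ∧ ∀ (f : V → ℝ) (τ : ℝ), Measurable f →
      (μ.prod μ).real {z | τ < |addDefect f z.1 z.2|} ≤ 1 / 16 →
        ∃ h : V →+ ℝ, ∀ p, ‖p‖ ≤ R → 15 * τ < |f p - h p| →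
          3 / 4 ≤ μ.real {x | τ < |addDefect f p x|} := by
  obtain ⟨ρ, hRρ, hstab⟩ := exists_radius_forall_isApproxAdditiveOn_exists_addMonoidHom V ℝ R
  obtain ⟨μ, hμ, hinv⟩ := exists_forall_isAlmostInvariantUnder V ρ (η := 1 / 16) (by norm_num)
  refine ⟨μ, hμ, fun f τ hf hdefect => ?_⟩
  choose! g hg using fun p hp => exists_isSelfCorrection hf (hinv p hp) hdefect
  have hgadd : IsApproxAdditiveOn g (closedBall 0 ρ) (3 * (2 * τ)) := by
    intro p hp q hq hpq
    rw [mem_closedBall_zero_iff] at hp hq hpq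
    exact (hg p hp).abs_sub_sub_le (hinv q hq) (hg q hq) (hg _ hpq)
  obtain ⟨h, hgh⟩ := hstab g _ hgadd
  refine ⟨h, fun p hp hfar => (hg p (hp.trans hRρ)).three_div_four_le_measureReal hf ?_⟩
  have hgh := hgh p hp
  rw [Real.norm_eq_abs] at hgh
  linarith [abs_sub_le (f p) (g p) (h p)]

theorem le_measureReal_ball_inter_of_isFarFromAdditive {n : ℕ}
    {D : Measure (EuclideanSpace ℝ (Fin n))} [IsProbabilityMeasure D] {β ε η R : ℝ}
    {f : EuclideanSpace ℝ (Fin n) → ℝ} (hD : IsConcentrated D η R)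
    (hfar : IsFarFromAdditive f D β ε) (h : EuclideanSpace ℝ (Fin n) →+ ℝ) :
    ε - η ≤ D.real (ball 0 R ∩ {p | β < |f p - h p|}) := by
  have hsub : {p | β < |f p - h p|} ⊆ (ball 0 R)ᶜ ∪ ball 0 R ∩ {p | β < |f p - h p|} := by
    intro p hp
    by_cases hpR : p ∈ ball 0 R
    · exact Or.inr ⟨hpR, hp⟩
    · exact Or.inl hpR
  have hle := (measureReal_mono (μ := D) hsub).trans (measureReal_union_le _ _)
  rw [probReal_compl_eq_one_sub measurableSet_ball] at hle
  have := hfar h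
  unfold IsConcentrated at hD
  linarith

theorem exists_measure_forall_le_measureReal_violationSet (n : ℕ) (R : ℝ) :
    ∃ μ : Measure (EuclideanSpace ℝ (Fin n)), IsProbabilityMeasure μ ∧
      ∀ (f : EuclideanSpace ℝ (Fin n) → ℝ) (τ ε : ℝ) (D : Measure (EuclideanSpace ℝ (Fin n)))
        [IsProbabilityMeasure D], Measurable f → IsConcentrated D (ε / 4) R →
          IsFarFromAdditive f D (15 * τ) ε →
            ε / 16 ≤ ((μ.prod μ).prod D).real (violationSet f τ) := by
  obtain ⟨μ, hμ, hcorrect⟩ :=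
    exists_measure_forall_exists_addMonoidHom (EuclideanSpace ℝ (Fin n)) R
  refine ⟨μ, hμ, fun f τ ε D _ hf hD hfar => ?_⟩
  by_cases hdefect : (μ.prod μ).real {z | τ < |addDefect f z.1 z.2|} ≤ 1 / 16
  · obtain ⟨h, hh⟩ := hcorrect f τ hf hdefect
    have hε : 0 ≤ ε := by linarith [hD.trans measureReal_le_one]
    have hmarkov := mul_measureReal_le_measureReal_prod D μ (θ := 3 / 4)
      (measurableSet_setOf_lt_abs_addDefect hf τ) (by norm_num)
      fun p (hp : p ∈ ball 0 R ∩ {p | 15 * τ < |f p - h p|}) =>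
        hh p (mem_ball_zero_iff.1 hp.1).le hp.2
    have := le_measureReal_ball_inter_of_isFarFromAdditive hD hfar h
    have := measureReal_lt_abs_addDefect_le_violationSet_sample (μ := μ) (D := D) hf τ
    linarith
  · have hε : ε ≤ 1 := (hfar 0).le.trans measureReal_le_one
    have := measureReal_lt_abs_addDefect_le_violationSet_coins (μ := μ) (D := D) hf τ
    linarith

end Detection

section Testers

variable {n : ℕ}

theorem Tester.answers_apply (T : Tester n) (f : EuclideanSpace ℝ (Fin n) → ℝ)
    (z : T.Coins × (Fin T.numSamples → EuclideanSpace ℝ (Fin n))) (k : ℕ) (i : Fin k) :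
    T.answers f z k i = f (T.query i (z.1, z.2, T.answers f z i)) := by
  induction k with
  | zero => exact i.elim0
  | succ k ih =>
    rw [answers]
    refine Fin.lastCases ?_ (fun j => ?_) i
    · simp
    · simpa using ih j

/-- A non-adaptive test that draws a single sample and accepts or rejects on the answers alone: the
building block that `TestRound.iterate` repeats independently. -/
structure TestRound (n : ℕ) where
  Coins : Type
  [measurableSpaceCoins : MeasurableSpace Coins]
  coinLaw : Measure Coins
  [isProbabilityMeasure_coinLaw : IsProbabilityMeasure coinLaw]
  numQueries : ℕ
  query : Fin numQueries → Coins × EuclideanSpace ℝ (Fin n) → EuclideanSpace ℝ (Fin n)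
  measurable_query : ∀ j, Measurable (query j)
  acceptSet : Set (Fin numQueries → ℝ)
  measurableSet_acceptSet : MeasurableSet acceptSet

namespace TestRound

attribute [instance] measurableSpaceCoins isProbabilityMeasure_coinLaw

/-- The event that the round `r` rejects `f`. -/
def rejectSet (r : TestRound n) (f : EuclideanSpace ℝ (Fin n) → ℝ) :
    Set (r.Coins × EuclideanSpace ℝ (Fin n)) :=
  {w | (fun j => f (r.query j w)) ∉ r.acceptSet}

theorem measurableSet_rejectSet (r : TestRound n) {f : EuclideanSpace ℝ (Fin n) → ℝ}
    (hf : Measurable f) : MeasurableSet (r.rejectSet f) :=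
  measurable_pi_lambda _ (fun j => hf.comp (r.measurable_query j)) r.measurableSet_acceptSet.compl

/-- The tester that runs `m` independent copies of the round `r` and accepts if all of them do.
Query `j` of copy `i` is query number `finProdFinEquiv (i, j)` of the tester. -/
noncomputable def iterate (r : TestRound n) (m : ℕ) : Tester n where
  numSamples := m
  numQueries := m * r.numQueries
  Coins := Fin m → r.Coins
  coinsMeasurableSpace := inferInstance
  coinLaw := Measure.pi fun _ => r.coinLaw
  coinLaw_isProbabilityMeasure := inferInstance
  query k z :=
    if h : k < m * r.numQueries then
      let ij := finProdFinEquiv.symm ⟨k, h⟩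
      r.query ij.2 (z.1 ij.1, z.2.1 ij.1)
    else 0
  measurable_query k := by
    split_ifs
    · exact (r.measurable_query _).comp (by fun_prop)
    · exact measurable_const
  acceptSet := {w | ∀ i, (fun j => w.2.2 (finProdFinEquiv (i, j))) ∈ r.acceptSet}
  measurableSet_acceptSet := by
    rw [Set.ofPred_forall]
    refine MeasurableSet.iInter fun i => ?_
    have : Measurable fun w : (Fin m → r.Coins) × (Fin m → EuclideanSpace ℝ (Fin n)) ×
        (Fin (m * r.numQueries) → ℝ) => fun j => w.2.2 (finProdFinEquiv (i, j)) := by fun_prop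
    exact this r.measurableSet_acceptSet

variable (r : TestRound n) (m : ℕ) (f : EuclideanSpace ℝ (Fin n) → ℝ)
  (D : Measure (EuclideanSpace ℝ (Fin n))) [IsProbabilityMeasure D]

theorem answers_iterate (z : (Fin m → r.Coins) × (Fin m → EuclideanSpace ℝ (Fin n))) (i : Fin m)
    (j : Fin r.numQueries) :
    (r.iterate m).answers f z (m * r.numQueries) (finProdFinEquiv (i, j)) =
      f (r.query j (z.1 i, z.2 i)) := by
  refine ((r.iterate m).answers_apply f z _ _).trans (congrArg f ?_)
  exact (dif_pos (finProdFinEquiv (i, j)).isLt).trans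
    (by simp only [Fin.eta, Equiv.symm_apply_apply])

theorem acceptEvent_iterate :
    (r.iterate m).acceptEvent f = {z | ∀ i, (z.1 i, z.2 i) ∉ r.rejectSet f} := by
  ext z
  refine forall_congr' fun i => ?_
  simp only [rejectSet, Set.mem_ofPred_eq, not_not, ← r.answers_iterate m f z i]
  rfl

theorem acceptProb_iterate_of_rejectSet_eq_empty (hf : r.rejectSet f = ∅) :
    (r.iterate m).acceptProb f D = 1 := by
  have : (r.iterate m).acceptEvent f = Set.univ := by
    simp only [acceptEvent_iterate, hf, Set.mem_empty_iff_false, not_false_eq_true, implies_true]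
    exact Set.ofPred_true
  unfold Tester.acceptProb Tester.runLaw
  rw [this, probReal_univ]

theorem rejectProb_iterate (hf : Measurable f) :
    (r.iterate m).rejectProb f D = 1 - (1 - (r.coinLaw.prod D).real (r.rejectSet f)) ^ m := by
  let e : (Fin m → r.Coins × EuclideanSpace ℝ (Fin n)) ≃ᵐ
      (r.iterate m).Coins × (Fin (r.iterate m).numSamples → EuclideanSpace ℝ (Fin n)) :=
    MeasurableEquiv.arrowProdEquivProdArrow r.Coins (EuclideanSpace ℝ (Fin n)) (Fin m)
  have he : MeasurePreserving e (Measure.pi fun _ => r.coinLaw.prod D) ((r.iterate m).runLaw D) :=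
    measurePreserving_arrowProdEquivProdArrow _ _ _ (fun _ => r.coinLaw) fun _ => D
  have hpre : e ⁻¹' (r.iterate m).acceptEvent f = Set.univ.pi fun _ => (r.rejectSet f)ᶜ := by
    rw [acceptEvent_iterate]
    ext w
    simp only [Set.mem_pi, Set.mem_univ, true_imp_iff]
    rfl
  have hmeas : MeasurableSet ((r.iterate m).acceptEvent f) := by
    rw [← e.measurableSet_preimage, hpre]
    exact .univ_pi fun _ => (r.measurableSet_rejectSet hf).compl
  have : IsProbabilityMeasure ((r.iterate m).runLaw D) := by
    unfold Tester.runLaw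
    infer_instance
  rw [Tester.rejectProb, probReal_compl_eq_one_sub hmeas,
    ← he.measureReal_preimage hmeas.nullMeasurableSet, hpre, measureReal_def, Measure.pi_pi,
    Finset.prod_const, Finset.card_univ, Fintype.card_fin, ENNReal.toReal_pow, ← measureReal_def,
    probReal_compl_eq_one_sub (r.measurableSet_rejectSet hf)]

end TestRound

theorem two_thirds_le_one_sub_one_sub_pow {x : ℝ} (hx : x ≤ 1) {m : ℕ} (hm : 2 ≤ m * x) :
    2 / 3 ≤ 1 - (1 - x) ^ m := by
  have hexp : (1 - x) ^ m ≤ Real.exp (-2) :=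
    calc (1 - x) ^ m ≤ Real.exp (-x) ^ m :=
          pow_le_pow_left₀ (sub_nonneg.2 hx) (Real.one_sub_le_exp_neg x) m
      _ = Real.exp (-(m * x)) := by rw [← Real.exp_nat_mul, mul_neg]
      _ ≤ Real.exp (-2) := by gcongr
  have hthird : Real.exp (-2) ≤ 1 / 3 := by
    rw [Real.exp_neg, ← one_div]
    exact one_div_le_one_div_of_le (by norm_num) (by linarith [Real.add_one_le_exp (2 : ℝ)])
  linarith

/-- One round of the additivity test: draw `x` and `y` from `μ` and a sample `p`, and check that `f`
is additive up to `τ` at `(x, y)` and at `(p, x)`. -/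
noncomputable def additivityRound (μ : Measure (EuclideanSpace ℝ (Fin n))) [IsProbabilityMeasure μ]
    (τ : ℝ) : TestRound n where
  Coins := EuclideanSpace ℝ (Fin n) × EuclideanSpace ℝ (Fin n)
  coinLaw := μ.prod μ
  numQueries := 5
  query := ![fun w => w.1.1, fun w => w.1.2, fun w => w.1.1 + w.1.2, fun w => w.2,
    fun w => w.2 + w.1.1]
  measurable_query j := by
    fin_cases j <;> dsimp <;> fun_prop
  acceptSet := {a | |a 2 - a 0 - a 1| ≤ τ ∧ |a 4 - a 3 - a 0| ≤ τ}
  measurableSet_acceptSet := by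
    rw [Set.ofPred_and]
    refine (measurableSet_le ?_ measurable_const).inter (measurableSet_le ?_ measurable_const) <;>
      fun_prop

variable (μ : Measure (EuclideanSpace ℝ (Fin n))) [IsProbabilityMeasure μ]
  {f : EuclideanSpace ℝ (Fin n) → ℝ}

theorem rejectSet_additivityRound (f : EuclideanSpace ℝ (Fin n) → ℝ) (τ : ℝ) :
    (additivityRound μ τ).rejectSet f = violationSet f τ := by
  ext w
  exact not_and_or.trans (or_congr not_le not_le)

theorem IsCloseToAdditive.abs_addDefect_le {α : ℝ} (hf : IsCloseToAdditive f α)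
    (x y : EuclideanSpace ℝ (Fin n)) : |addDefect f x y| ≤ 3 * α := by
  obtain ⟨h, hh⟩ := hf
  have hx := abs_le.1 (hh x)
  have hy := abs_le.1 (hh y)
  have hxy := abs_le.1 (hh (x + y))
  rw [map_add] at hxy
  rw [addDefect, abs_le]
  constructor <;> linarith

theorem IsCloseToAdditive.violationSet_eq_empty {α : ℝ} (hf : IsCloseToAdditive f α) :
    violationSet f (3 * α) = ∅ :=
  Set.eq_empty_of_forall_notMem fun _ hw =>
    hw.elim (hf.abs_addDefect_le _ _).not_gt (hf.abs_addDefect_le _ _).not_gt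

theorem IsFarFromAdditive.mono {D : Measure (EuclideanSpace ℝ (Fin n))} [IsFiniteMeasure D]
    {β β' ε : ℝ} (hf : IsFarFromAdditive f D β' ε) (hβ : β ≤ β') : IsFarFromAdditive f D β ε :=
  fun h => (hf h).trans_le (measureReal_mono fun _ hp => hβ.trans_lt hp)

end Testers

theorem mainTheorem8_general :
    ∃ C K : ℝ, 0 < C ∧ 0 < K ∧
      ∀ (n : ℕ) (α ε R : ℝ), 0 < ε →
        ∃ T : Tester n,
          ((T.numQueries + T.numSamples : ℕ) : ℝ) ≤ C / ε ∧
          ∀ (f : EuclideanSpace ℝ (Fin n) → ℝ), Measurable f →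
            ∀ (D : Measure (EuclideanSpace ℝ (Fin n))) [IsProbabilityMeasure D],
              IsConcentrated D (ε / 4) R →
                (IsCloseToAdditive f α → T.acceptProb f D = 1) ∧
                (IsFarFromAdditive f D (K * α) ε → 2 / 3 ≤ T.rejectProb f D) := by
  refine ⟨198, 45, by norm_num, by norm_num, fun n α ε R hε => ?_⟩
  obtain ⟨μ, hμ, hviolation⟩ := exists_measure_forall_le_measureReal_violationSet n R
  let r := additivityRound μ (3 * α)
  -- Rounding down: for large `ε` the bound `C / ε` is below one call, and no call is made.
  let m := ⌊33 / ε⌋₊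
  refine ⟨r.iterate m, ?calls, fun f hf D _ hD => ⟨fun hclose => ?accept, fun hfar => ?reject⟩⟩
  case calls =>
    calc ((m * 5 + m : ℕ) : ℝ) = 6 * m := by push_cast; ring
      _ ≤ 6 * (33 / ε) := by gcongr; exact Nat.floor_le (by positivity)
      _ = 198 / ε := by ring
  case accept =>
    exact r.acceptProb_iterate_of_rejectSet_eq_empty m f D
      ((rejectSet_additivityRound μ f _).trans hclose.violationSet_eq_empty)
  case reject =>
    have hε1 : ε ≤ 1 := (hfar 0).le.trans measureReal_le_one
    have hm : 33 < (m + 1) * ε := (div_lt_iff₀ hε).1 (Nat.lt_floor_add_one _)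
    rw [r.rejectProb_iterate m f D hf, rejectSet_additivityRound]
    refine two_thirds_le_one_sub_one_sub_pow measureReal_le_one ?_
    calc (2 : ℝ) ≤ m * (ε / 16) := by linarith
      _ ≤ _ := by gcongr; exact hviolation f _ ε D hf hD (hfar.mono (by linarith))

theorem mainTheorem8 :
    ∃ C K : ℝ, 0 < C ∧ 0 < K ∧
      ∀ (n : ℕ) (α ε R : ℝ), 0 < α → 0 < ε → 1 ≤ R * (n : ℝ) ^ (1.5 : ℝ) →
        ∃ T : Tester n,
          ((T.numQueries + T.numSamples : ℕ) : ℝ) ≤ C / ε ∧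
          ∀ (f : EuclideanSpace ℝ (Fin n) → ℝ), Measurable f →
            ∀ (D : Measure (EuclideanSpace ℝ (Fin n))) [IsProbabilityMeasure D],
              IsConcentrated D (ε / 4) R →
                (IsCloseToAdditive f α → T.acceptProb f D = 1) ∧
                (IsFarFromAdditive f D (K * (R * (n : ℝ) ^ (1.5 : ℝ) * α)) ε →
                  2 / 3 ≤ T.rejectProb f D) := by
  obtain ⟨C, K, hC, hK, htester⟩ := mainTheorem8_general
  refine ⟨C, K, hC, hK, fun n α ε R hα hε hR => ?_⟩
  obtain ⟨T, hcalls, hT⟩ := htester n α ε R hε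
  have hβ : K * α ≤ K * (R * (n : ℝ) ^ (1.5 : ℝ) * α) := by
    gcongr
    exact le_mul_of_one_le_left hα.le hR
  exact ⟨T, hcalls, fun f hf D _ hD =>
    ⟨(hT f hf D hD).1, fun hfar => (hT f hf D hD).2 (hfar.mono hβ)⟩⟩
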